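/- Let $1<q<2$ and $\alpha>0$, and let $\Omega\subset\mathbb{R}^N$ be an open bounded connected set. Let $W^{1,2}_0(\Omega)$ be the closure of $C^\infty_0(\Omega)$ with respect to the norm $\|\varphi\|_{L^2(\Omega)}+\|\nabla\varphi\|_{L^2(\Omega;\mathbb{R}^N)}$, endowed with the topology of this norm (which, by the Poincaré inequality, is also the topology of the norm $\|\nabla\varphi\|_{L^2(\Omega;\mathbb{R}^N)}$), and set \[ \mathfrak{F}_{q,\alpha}(\varphi)=\frac12\int_\Omega|\nabla\varphi|^2\,dx-\frac{\alpha}{q}\int_\Omega|\varphi|^q\,dx,\qquad \varphi\in W^{1,2}_0(\Omega). \] Let $w$ be the positive minimizer of $\mathfrak{F}_{q,\alpha}$ over $W^{1,2}_0(\Omega)$, that is, $w\in W^{1,2}_0(\Omega)$, $w>0$ almost everywhere in $\Omega$, and $\mathfrak{F}_{q,\alpha}(w)\le\mathfrak{F}_{q,\alpha}(v)$ for every $v\in W^{1,2}_0(\Omega)$. Then for every $\varphi\in W^{1,2}_0(\Omega)$, with positive part $\varphi^+=\max\{\varphi,0\}\in W^{1,2}_0(\Omega)$, there exists a continuous path $\gamma:[0,1]\to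 W^{1,2}_0(\Omega)$ such that 1. $\gamma(0)=w$ and $\gamma(1)=\varphi$; 2. $\mathfrak{F}_{q,\alpha}(\gamma(t))\le\max\big\{\mathfrak{F}_{q,\alpha}(\varphi^+),\,\mathfrak{F}_{q,\alpha}(\varphi)\big\}$ for every $t\in[0,1]$. -/

import Mathlib

open MeasureTheory
open scoped ContDiff Gradient

noncomputable section

/-- The space `L²(Ω)`. -/
abbrev L2Fun {N : ℕ} (Ω : Set (EuclideanSpace ℝ (Fin N))) : Type :=
  Lp ℝ 2 (volume.restrict Ω)

/-- The space `L²(Ω; ℝᴺ)`. -/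
abbrev L2Vec {N : ℕ} (Ω : Set (EuclideanSpace ℝ (Fin N))) : Type :=
  Lp (EuclideanSpace ℝ (Fin N)) 2 (volume.restrict Ω)

/-- `f` is a test function on `Ω`, i.e. `f ∈ C₀^∞(Ω)`. -/
def IsTestFunction {N : ℕ} (Ω : Set (EuclideanSpace ℝ (Fin N)))
    (f : EuclideanSpace ℝ (Fin N) → ℝ) : Prop :=
  ContDiff ℝ ∞ f ∧ HasCompactSupport f ∧ tsupport f ⊆ Ω

/-- The pairs `(f, ∇f)` with `f ∈ C₀^∞(Ω)`, as a subspace of `L²(Ω) × L²(Ω; ℝᴺ)`. -/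
def testGraph {N : ℕ} (Ω : Set (EuclideanSpace ℝ (Fin N))) :
    Submodule ℝ (L2Fun Ω × L2Vec Ω) where
  carrier := {p | ∃ f : EuclideanSpace ℝ (Fin N) → ℝ, IsTestFunction Ω f ∧
    p.1 =ᵐ[volume.restrict Ω] f ∧ p.2 =ᵐ[volume.restrict Ω] ∇ f}
  zero_mem' := by
    refine ⟨fun _ => 0, ⟨contDiff_const, HasCompactSupport.zero, by simp [tsupport]⟩,
      Lp.coeFn_zero _ _ _, ?_⟩
    rw [gradient_fun_const']
    exact Lp.coeFn_zero _ _ _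
  add_mem' := by
    rintro p r ⟨f, ⟨hf, hfc, hfs⟩, hp1, hp2⟩ ⟨g, ⟨hg, hgc, hgs⟩, hr1, hr2⟩
    refine ⟨f + g, ⟨hf.add hg, hfc.add hgc,
      (tsupport_add f g).trans (Set.union_subset hfs hgs)⟩, ?_, ?_⟩
    · exact (Lp.coeFn_add _ _).trans (hp1.add hr1)
    · refine (Lp.coeFn_add _ _).trans ((hp2.add hr2).trans (Filter.Eventually.of_forall ?_))
      intro x
      simp only [gradient, Pi.add_apply]
      rw [fderiv_add (hf.differentiable (by simp) x) (hg.differentiable (by simp) x), map_add]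
  smul_mem' := by
    rintro c p ⟨f, ⟨hf, hfc, hfs⟩, hp1, hp2⟩
    refine ⟨c • f, ⟨hf.const_smul c, hfc.mono (Function.support_const_smul_subset c f),
      (closure_mono (Function.support_const_smul_subset c f)).trans hfs⟩, ?_, ?_⟩
    · exact (Lp.coeFn_smul _ _).trans (hp1.const_smul c)
    · refine (Lp.coeFn_smul _ _).trans
        ((hp2.const_smul c).trans (Filter.Eventually.of_forall ?_))
      intro x
      simp only [gradient, Pi.smul_apply]
      rw [fderiv_const_smul (hf.differentiable (by simp) x), map_smulₛₗ]
      simp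

/-- The space `W₀^{1,2}(Ω)`, the closure of `C₀^∞(Ω)` for the norm `‖u‖_{L²} + ‖∇u‖_{L²}`.
An element is the pair `(u, ∇u)` of a function and its weak gradient (the second component is
determined by the first, see `W012.ext_fn`); the topology is the one of
`L²(Ω) × L²(Ω; ℝᴺ)`, that is, the topology of this norm. -/
def W012 {N : ℕ} (Ω : Set (EuclideanSpace ℝ (Fin N))) : Submodule ℝ (L2Fun Ω × L2Vec Ω) :=
  (testGraph Ω).topologicalClosure

/-- The function underlying an element of `W₀^{1,2}(Ω)`. -/
def W012.fn {N : ℕ} {Ω : Set (EuclideanSpace ℝ (Fin N))} (u : W012 Ω) : L2Fun Ω := u.1.1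

/-- The weak gradient of an element of `W₀^{1,2}(Ω)`. -/
def W012.grad {N : ℕ} {Ω : Set (EuclideanSpace ℝ (Fin N))} (u : W012 Ω) : L2Vec Ω := u.1.2

/-- The functional `½ ∫_Ω |∇u|² dx - (α/q) ∫_Ω |u|^q dx` on `W₀^{1,2}(Ω)`. -/
def energy {N : ℕ} {Ω : Set (EuclideanSpace ℝ (Fin N))} (q α : ℝ) (u : W012 Ω) : ℝ :=
  1 / 2 * (∫ x in Ω, ‖W012.grad u x‖ ^ 2) - α / q * (∫ x in Ω, |W012.fn u x| ^ q)

/-- `w` is a positive minimizer of the energy functional over `W₀^{1,2}(Ω)`. -/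
def IsPositiveMinimizer {N : ℕ} {Ω : Set (EuclideanSpace ℝ (Fin N))} (q α : ℝ)
    (w : W012 Ω) : Prop :=
  (∀ v : W012 Ω, energy q α w ≤ energy q α v) ∧ ∀ᵐ x ∂(volume.restrict Ω), 0 < W012.fn w x

/-- Integration by parts in `W₀^{1,2}(Ω)`: `W012.grad u` is the weak gradient of `W012.fn u`. -/
theorem W012.integral_smul_grad {N : ℕ} {Ω : Set (EuclideanSpace ℝ (Fin N))} (u : W012 Ω)
    {ψ : EuclideanSpace ℝ (Fin N) → ℝ} (hψ : IsTestFunction Ω ψ)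
    (e : EuclideanSpace ℝ (Fin N)) :
    ∫ x in Ω, ψ x * inner ℝ e (W012.grad u x) = - ∫ x in Ω, fderiv ℝ ψ x e * W012.fn u x := by
  obtain ⟨hψ, hψc, hψs⟩ := hψ
  have hD : Continuous fun x => fderiv ℝ ψ x e :=
    (hψ.continuous_fderiv (by simp)).clm_apply continuous_const
  have hDc : HasCompactSupport fun x => fderiv ℝ ψ x e :=
    (hψc.fderiv (𝕜 := ℝ)).comp_left (g := fun L : EuclideanSpace ℝ (Fin N) →L[ℝ] ℝ => L e) rfl
  have hA : MemLp (fun x => ψ x • e) 2 (volume.restrict Ω) :=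
    ((hψ.continuous.smul continuous_const).memLp_of_hasCompactSupport
      (hψc.smul_right)).restrict Ω
  have hB : MemLp (fun x => fderiv ℝ ψ x e) 2 (volume.restrict Ω) :=
    (hD.memLp_of_hasCompactSupport hDc).restrict Ω
  have key : ∀ p : L2Fun Ω × L2Vec Ω,
      inner ℝ (hA.toLp _) p.2 + inner ℝ (hB.toLp _) p.1
        = (∫ x in Ω, ψ x * inner ℝ e (p.2 x)) + ∫ x in Ω, fderiv ℝ ψ x e * p.1 x := by
    intro p
    rw [L2.inner_def, L2.inner_def]
    congr 1
    · refine integral_congr_ae ?_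
      filter_upwards [hA.coeFn_toLp] with x hx
      rw [hx, real_inner_smul_left]
    · refine integral_congr_ae ?_
      filter_upwards [hB.coeFn_toLp] with x hx
      rw [hx]
      simp [mul_comm]
  have hclosed : IsClosed {p : L2Fun Ω × L2Vec Ω |
      inner ℝ (hA.toLp _) p.2 + inner ℝ (hB.toLp _) p.1 = 0} :=
    isClosed_eq (by fun_prop) continuous_const
  have hsub : (testGraph Ω : Set (L2Fun Ω × L2Vec Ω)) ⊆ {p : L2Fun Ω × L2Vec Ω |
      inner ℝ (hA.toLp _) p.2 + inner ℝ (hB.toLp _) p.1 = 0} := by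
    rintro p ⟨f, ⟨hf, hfc, hfs⟩, hp1, hp2⟩
    have hDf : Continuous fun x => fderiv ℝ f x e :=
      (hf.continuous_fderiv (by simp)).clm_apply continuous_const
    rw [Set.mem_ofPred_eq, key]
    have h1 : ∫ x in Ω, ψ x * inner ℝ e (p.2 x) = ∫ x, ψ x * fderiv ℝ f x e := by
      rw [← setIntegral_eq_integral_of_forall_compl_eq_zero (s := Ω)
        (f := fun x => ψ x * fderiv ℝ f x e)]
      · refine integral_congr_ae ?_
        filter_upwards [hp2] with x hx
        rw [hx, real_inner_comm]
        simp [gradient]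
      · intro x hx
        rw [image_eq_zero_of_notMem_tsupport (fun h => hx (hψs h)), zero_mul]
    have h2 : ∫ x in Ω, fderiv ℝ ψ x e * p.1 x = ∫ x, fderiv ℝ ψ x e * f x := by
      rw [← setIntegral_eq_integral_of_forall_compl_eq_zero (s := Ω)
        (f := fun x => fderiv ℝ ψ x e * f x)]
      · refine integral_congr_ae ?_
        filter_upwards [hp1] with x hx
        rw [hx]
      · intro x hx
        rw [image_eq_zero_of_notMem_tsupport (fun h => hx (hfs h)), mul_zero]
    rw [h1, h2, integral_mul_fderiv_eq_neg_fderiv_mul_of_integrable, neg_add_cancel]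
    · exact (hD.mul hf.continuous).integrable_of_hasCompactSupport hDc.mul_right
    · exact (hψ.continuous.mul hDf).integrable_of_hasCompactSupport hψc.mul_right
    · exact (hψ.continuous.mul hf.continuous).integrable_of_hasCompactSupport hψc.mul_right
    · exact fun x _ => hψ.differentiable (by simp) x
    · exact fun x _ => hf.differentiable (by simp) x
  have hu := closure_minimal hsub hclosed u.2
  rw [Set.mem_ofPred_eq, key] at hu
  exact eq_neg_of_add_eq_zero_left hu

/-- On an open set, an element of `W₀^{1,2}(Ω)` is determined by the underlying function. -/
theorem W012.ext_fn {N : ℕ} {Ω : Set (EuclideanSpace ℝ (Fin N))} (hΩ : IsOpen Ω)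
    {u v : W012 Ω} (h : W012.fn u = W012.fn v) : u = v := by
  have hL : LocallyIntegrableOn (fun x => (W012.grad (u - v)) x) Ω volume :=
    locallyIntegrableOn_of_locallyIntegrable_restrict
      ((Lp.memLp (W012.grad (u - v))).locallyIntegrable (by norm_num))
  have hfn : (W012.fn (u - v)) = 0 := sub_eq_zero.2 h
  have h0 : ∀ᵐ x ∂volume, x ∈ Ω → (W012.grad (u - v)) x = 0 := by
    refine hΩ.ae_eq_zero_of_integral_contDiff_smul_eq_zero hL ?_
    intro ψ hψ hψc hψs
    have hint : Integrable (fun x => ψ x • (W012.grad (u - v)) x) (volume.restrict Ω) :=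
      memLp_one_iff_integrable.1 ((Lp.memLp (W012.grad (u - v))).smul
        ((hψ.continuous.memLp_of_hasCompactSupport hψc).restrict Ω : MemLp ψ 2 _))
    rw [← setIntegral_eq_integral_of_forall_compl_eq_zero (s := Ω)]
    · refine ext_inner_left ℝ fun e => ?_
      rw [← integral_inner hint, inner_zero_right]
      simp only [real_inner_smul_right]
      rw [W012.integral_smul_grad (u - v) ⟨hψ, hψc, hψs⟩ e, hfn, neg_eq_zero]
      refine integral_eq_zero_of_ae ?_
      filter_upwards [Lp.coeFn_zero ℝ 2 (volume.restrict Ω)] with x hx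
      rw [hx]
      simp
    · intro x hx
      rw [image_eq_zero_of_notMem_tsupport (fun h => hx (hψs h)), zero_smul]
  have hgrad : (W012.grad (u - v)) = 0 := by
    refine (Lp.eq_zero_iff_ae_eq_zero).2 ?_
    exact (ae_restrict_iff' hΩ.measurableSet).2 h0
  refine sub_eq_zero.1 (Subtype.ext (Prod.ext hfn hgrad))

end

/-! The path has two legs, joined at `φ⁺`.

From `w` to `φ⁺`, hidden convexity is used: along `z_t = √((1 - t) w² + t (φ⁺)²)` the energy is
convex. The Dirichlet term satisfies `|∇z_t|² ≤ (1 - t)|∇w|² + t|∇φ⁺|²` by Cauchy–Schwarz, and `∫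
z_t^q` is concave in `t` because `s ↦ s^(q/2)` is concave for `q < 2`. Hence the energy of `z_t` is
at most `(1 - t) F(w) + t F(φ⁺)`, which is at most `F(φ⁺)` by minimality of `w`. These are
`energy_le_of_sqrt_convexCombination` and `W012.exists_path_energy_le`.

From `φ⁺` to `φ = φ⁺ - φ⁻`, the segment `φ⁺ - t φ⁻` is used. The two parts live on disjoint sets, so
the energy is `F(φ⁺) + A t² - B t^q` with `A ≥ 0`, and `t² ≤ t^q` on `[0, 1]` bounds it by the
larger of its end values. This is `W012.joinedIn_posPart`.

Both legs rest on `W012.exists_sqrt_sq_add_sq`: the space is stable under `(u, v) ↦ √(u² + v²)`,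
with the expected gradient. The case `v = 0` gives absolute values, positive parts, and the
vanishing of the gradient on the zero set of a nonnegative function. -/

noncomputable section

open Filter Topology

/-! ### Convergence in `L²` of products with bounded coefficients. -/

/-- Dominated convergence in `L²`. -/
theorem Lp.tendsto_of_dominated {X E ι : Type*} [MeasurableSpace X] {μ : Measure X}
    [NormedAddCommGroup E] {l : Filter ι} [l.IsCountablyGenerated]
    {f : ι → Lp E 2 μ} {g : Lp E 2 μ} {F : ι → X → E} {G : X → E} {b : X → ℝ}
    (hf : ∀ i, f i =ᵐ[μ] F i) (hg : g =ᵐ[μ] G) (hb : MemLp b 2 μ)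
    (hbound : ∀ i, ∀ᵐ x ∂μ, ‖F i x‖ ≤ b x)
    (hlim : ∀ᵐ x ∂μ, Tendsto (fun i => F i x) l (𝓝 (G x))) :
    Tendsto f l (𝓝 g) := by
  rw [Lp.tendsto_Lp_iff_tendsto_eLpNorm']
  have hG : MemLp G 2 μ := (memLp_congr_ae hg).1 (Lp.memLp g)
  have hB : MemLp (fun x => b x + ‖G x‖) 2 μ := hb.add hG.norm
  have hfin := lintegral_rpow_enorm_lt_top_of_eLpNorm_lt_top (by norm_num) (by norm_num)
    hB.eLpNorm_lt_top
  have hF : ∀ i, MemLp (F i) 2 μ := fun i => (memLp_congr_ae (hf i)).1 (Lp.memLp (f i))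
  have key : Tendsto (fun i => ∫⁻ x, ‖(F i - G) x‖ₑ ^ (2 : ENNReal).toReal ∂μ) l
      (𝓝 (∫⁻ _, 0 ∂μ)) := by
    refine tendsto_lintegral_filter_of_dominated_convergence'
      (fun x => ‖b x + ‖G x‖‖ₑ ^ (2 : ENNReal).toReal) (.of_forall fun i => ?_)
      (.of_forall fun i => ?_) hfin.ne ?_
    · exact ((hF i).sub hG).aestronglyMeasurable.enorm.pow_const _
    · filter_upwards [hbound i] with x hx
      refine ENNReal.rpow_le_rpow (enorm_le_iff_norm_le.2 ?_) (by norm_num)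
      rw [Real.norm_of_nonneg (add_nonneg ((norm_nonneg _).trans hx) (norm_nonneg _))]
      exact (norm_sub_le _ _).trans (add_le_add_left hx _)
    · filter_upwards [hlim] with x hx
      have h := ((hx.sub_const (G x)).enorm).ennrpow_const (2 : ENNReal).toReal
      simpa using h
  have h := key.ennrpow_const (1 / (2 : ENNReal).toReal)
  rw [lintegral_zero, ENNReal.zero_rpow_of_pos (by norm_num)] at h
  refine h.congr fun i => ?_
  rw [eLpNorm_congr_ae ((hf i).sub hg),
    eLpNorm_eq_lintegral_rpow_enorm_toReal (by norm_num) (by norm_num)]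

theorem Lp.memLp_smul {X E : Type*} [MeasurableSpace X] {μ : Measure X}
    [NormedAddCommGroup E] [NormedSpace ℝ E] (F : Lp E 2 μ) {a : X → ℝ}
    (ham : AEStronglyMeasurable a μ) (ha : ∀ x, |a x| ≤ 1) :
    MemLp (fun x => a x • F x) 2 μ :=
  (Lp.memLp F).of_le (ham.smul (Lp.aestronglyMeasurable F)) <| .of_forall fun x => by
    rw [norm_smul]
    exact mul_le_of_le_one_left (norm_nonneg _) (ha x)

theorem Lp.memLp_smul_add_smul {X E : Type*} [MeasurableSpace X] {μ : Measure X}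
    [NormedAddCommGroup E] [NormedSpace ℝ E] (F G : Lp E 2 μ) {a b : X → ℝ}
    (ham : AEStronglyMeasurable a μ) (hbm : AEStronglyMeasurable b μ)
    (ha : ∀ x, |a x| ≤ 1) (hb : ∀ x, |b x| ≤ 1) :
    MemLp (fun x => a x • F x + b x • G x) 2 μ :=
  (Lp.memLp_smul F ham ha).add (Lp.memLp_smul G hbm hb)

/-- If `Fₙ → G` in `L²` and `aₙ → A` pointwise with `|aₙ| ≤ 1`, then `aₙ Fₙ → A G` in `L²`. -/
theorem Lp.tendsto_of_tendsto_smul {X E : Type*} [MeasurableSpace X] {μ : Measure X}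
    [NormedAddCommGroup E] [NormedSpace ℝ E]
    {f F : ℕ → Lp E 2 μ} {g G : Lp E 2 μ} {a : ℕ → X → ℝ} {A : X → ℝ}
    (hf : ∀ n, f n =ᵐ[μ] fun x => a n x • F n x) (hg : g =ᵐ[μ] fun x => A x • G x)
    (ham : ∀ n, AEStronglyMeasurable (a n) μ) (ha : ∀ n x, |a n x| ≤ 1)
    (hlim : ∀ᵐ x ∂μ, Tendsto (fun n => a n x) atTop (𝓝 (A x)))
    (hF : Tendsto F atTop (𝓝 G)) :
    Tendsto f atTop (𝓝 g) := by
  -- Split `aₙ Fₙ - A G = aₙ (Fₙ - G) + (aₙ - A) G`: the second term tends to zero by domination,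
  -- the first because `|aₙ| ≤ 1`.
  have hm : ∀ n, MemLp (fun x => a n x • G x) 2 μ := fun n => Lp.memLp_smul G (ham n) (ha n)
  have h1 : Tendsto (fun n => (hm n).toLp) atTop (𝓝 g) :=
    Lp.tendsto_of_dominated (fun n => (hm n).coeFn_toLp) hg (Lp.memLp G).norm
      (fun n => .of_forall fun x => by
        rw [norm_smul]
        exact mul_le_of_le_one_left (norm_nonneg _) (ha n x))
      (hlim.mono fun x hx => hx.smul_const _)
  have h2 : Tendsto (fun n => f n - (hm n).toLp) atTop (𝓝 0) := by
    refine squeeze_zero_norm (fun n => ?_) (tendsto_iff_norm_sub_tendsto_zero.1 hF)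
    refine Lp.norm_le_norm_of_ae_le ?_
    filter_upwards [hf n, (hm n).coeFn_toLp, Lp.coeFn_sub (f n) ((hm n).toLp),
      Lp.coeFn_sub (F n) G] with x h1 h2 h3 h4
    rw [h3, h4, Pi.sub_apply, Pi.sub_apply, h1, h2, ← smul_sub, norm_smul]
    exact mul_le_of_le_one_left (norm_nonneg _) (ha n x)
  simpa using h2.add h1

/-- Both `√(f² + g² + ε²) - ε` and its gradient have this two-term shape, so one lemma serves for
functions and gradients. -/
theorem Lp.tendsto_of_tendsto_smul_add_smul {X E : Type*} [MeasurableSpace X] {μ : Measure X}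
    [NormedAddCommGroup E] [NormedSpace ℝ E]
    {f F H : ℕ → Lp E 2 μ} {g G K : Lp E 2 μ} {a b : ℕ → X → ℝ} {A B : X → ℝ}
    (hf : ∀ n, f n =ᵐ[μ] fun x => a n x • F n x + b n x • H n x)
    (hg : g =ᵐ[μ] fun x => A x • G x + B x • K x)
    (ham : ∀ n, AEStronglyMeasurable (a n) μ) (hbm : ∀ n, AEStronglyMeasurable (b n) μ)
    (ha : ∀ n x, |a n x| ≤ 1) (hb : ∀ n x, |b n x| ≤ 1)
    (hAm : AEStronglyMeasurable A μ) (hA : ∀ x, |A x| ≤ 1)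
    (halim : ∀ᵐ x ∂μ, Tendsto (fun n => a n x) atTop (𝓝 (A x)))
    (hblim : ∀ᵐ x ∂μ, Tendsto (fun n => b n x) atTop (𝓝 (B x)))
    (hF : Tendsto F atTop (𝓝 G)) (hH : Tendsto H atTop (𝓝 K)) :
    Tendsto f atTop (𝓝 g) := by
  have hfm : ∀ n, MemLp (fun x => a n x • F n x) 2 μ := fun n => Lp.memLp_smul (F n) (ham n) (ha n)
  have hgm : MemLp (fun x => A x • G x) 2 μ := Lp.memLp_smul G hAm hA
  have h1 : Tendsto (fun n => (hfm n).toLp) atTop (𝓝 hgm.toLp) :=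
    Lp.tendsto_of_tendsto_smul (fun n => (hfm n).coeFn_toLp) hgm.coeFn_toLp ham ha halim hF
  have h2 : Tendsto (fun n => f n - (hfm n).toLp) atTop (𝓝 (g - hgm.toLp)) := by
    refine Lp.tendsto_of_tendsto_smul (fun n => ?_) ?_ hbm hb hblim hH
    · filter_upwards [hf n, (hfm n).coeFn_toLp, Lp.coeFn_sub (f n) ((hfm n).toLp)] with x h1 h2 h3
      rw [h3, Pi.sub_apply, h1, h2, add_sub_cancel_left]
    · filter_upwards [hg, hgm.coeFn_toLp, Lp.coeFn_sub g hgm.toLp] with x h1 h2 h3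
      rw [h3, Pi.sub_apply, h1, h2, add_sub_cancel_left]
  simpa using h1.add h2

/-! ### Stability of `W₀^{1,2}(Ω)` under `(u, v) ↦ √(u² + v²)`. -/

/-- A smooth approximation of the Euclidean norm of `(a, b)` which vanishes at the origin. -/
def smoothNorm (ε a b : ℝ) : ℝ := √(a ^ 2 + b ^ 2 + ε ^ 2) - ε

theorem abs_le_sqrt_add_sq (a b ε : ℝ) : |a| ≤ √(a ^ 2 + b ^ 2 + ε ^ 2) :=
  Real.abs_le_sqrt (by nlinarith [sq_nonneg b, sq_nonneg ε])

theorem abs_le_sqrt_add_sq' (a b ε : ℝ) : |b| ≤ √(a ^ 2 + b ^ 2 + ε ^ 2) :=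
  Real.abs_le_sqrt (by nlinarith [sq_nonneg a, sq_nonneg ε])

theorem sqrt_add_sq_pos {ε : ℝ} (hε : 0 < ε) (a b : ℝ) : 0 < √(a ^ 2 + b ^ 2 + ε ^ 2) :=
  Real.sqrt_pos.2 (by positivity)

/-- Rationalizing `S - ε = (S² - ε²) / (S + ε)`. The resulting coefficients of `a` and `b` are
continuous and bounded by 1, as in the formula for the gradient. -/
theorem smoothNorm_eq {ε : ℝ} (hε : 0 < ε) (a b : ℝ) :
    smoothNorm ε a b = a / (√(a ^ 2 + b ^ 2 + ε ^ 2) + ε) * a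
      + b / (√(a ^ 2 + b ^ 2 + ε ^ 2) + ε) * b := by
  have h := Real.sq_sqrt (show 0 ≤ a ^ 2 + b ^ 2 + ε ^ 2 by positivity)
  have h0 := sqrt_add_sq_pos hε a b
  rw [smoothNorm]
  field_simp
  linarith

theorem abs_div_le_one_of_abs_le {a s : ℝ} (h : |a| ≤ s) : |a / s| ≤ 1 := by
  rw [abs_div, abs_of_nonneg ((abs_nonneg a).trans h)]
  exact div_le_one_of_le₀ h ((abs_nonneg a).trans h)

section

variable {N : ℕ} {Ω : Set (EuclideanSpace ℝ (Fin N))}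

theorem IsTestFunction.smoothNorm {f g : EuclideanSpace ℝ (Fin N) → ℝ} {ε : ℝ} (hε : 0 < ε)
    (hf : IsTestFunction Ω f) (hg : IsTestFunction Ω g) :
    IsTestFunction Ω (fun x => smoothNorm ε (f x) (g x)) := by
  have hsub : tsupport (fun x => _root_.smoothNorm ε (f x) (g x)) ⊆ tsupport f ∪ tsupport g := by
    refine closure_minimal (fun x hx => ?_)
      ((isClosed_tsupport f).union (isClosed_tsupport g))
    by_contra h
    rw [Set.mem_union, not_or] at h
    apply hx
    simp [_root_.smoothNorm, image_eq_zero_of_notMem_tsupport h.1,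
      image_eq_zero_of_notMem_tsupport h.2, Real.sqrt_sq hε.le]
  refine ⟨?_, ?_, hsub.trans (Set.union_subset hf.2.2 hg.2.2)⟩
  · refine ContDiff.sub (ContDiff.sqrt (((hf.1.pow 2).add (hg.1.pow 2)).add contDiff_const)
      fun x => ?_) contDiff_const
    positivity
  · exact (hf.2.1.isCompact.union hg.2.1.isCompact).of_isClosed_subset (isClosed_tsupport _) hsub

theorem gradient_smoothNorm {f g : EuclideanSpace ℝ (Fin N) → ℝ} {ε : ℝ} (hε : 0 < ε)
    {x : EuclideanSpace ℝ (Fin N)} (hf : DifferentiableAt ℝ f x) (hg : DifferentiableAt ℝ g x) :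
    ∇ (fun x => smoothNorm ε (f x) (g x)) x
      = (f x / √(f x ^ 2 + g x ^ 2 + ε ^ 2)) • ∇ f x
        + (g x / √(f x ^ 2 + g x ^ 2 + ε ^ 2)) • ∇ g x := by
  have h := ((((hf.hasFDerivAt.pow 2).add (hg.hasFDerivAt.pow 2)).add_const (ε ^ 2)).sqrt
    (show f x ^ 2 + g x ^ 2 + ε ^ 2 ≠ 0 by positivity)).sub_const ε
  have h' : HasFDerivAt (fun x => smoothNorm ε (f x) (g x)) _ x := h
  rw [gradient, h'.fderiv, gradient, gradient]
  apply (InnerProductSpace.toDual ℝ (EuclideanSpace ℝ (Fin N))).injective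
  have := sqrt_add_sq_pos hε (f x) (g x)
  ext v
  simp
  field_simp

theorem IsTestFunction.memLp {f : EuclideanSpace ℝ (Fin N) → ℝ} (hf : IsTestFunction Ω f) :
    MemLp f 2 (volume.restrict Ω) :=
  (hf.1.continuous.memLp_of_hasCompactSupport hf.2.1).restrict Ω

theorem IsTestFunction.memLp_gradient {f : EuclideanSpace ℝ (Fin N) → ℝ}
    (hf : IsTestFunction Ω f) : MemLp (∇ f) 2 (volume.restrict Ω) := by
  have hc : Continuous (∇ f) :=
    (InnerProductSpace.toDual ℝ (EuclideanSpace ℝ (Fin N))).symm.continuous.comp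
      (hf.1.continuous_fderiv (by simp))
  have hs : HasCompactSupport (∇ f) :=
    (hf.2.1.fderiv (𝕜 := ℝ)).comp_left
      (g := (InnerProductSpace.toDual ℝ (EuclideanSpace ℝ (Fin N))).symm) (map_zero _)
  exact (hc.memLp_of_hasCompactSupport hs).restrict Ω

theorem Lp.exists_subseq_tendsto_ae {X E : Type*} [MeasurableSpace X] {μ : Measure X}
    [NormedAddCommGroup E] {f : ℕ → Lp E 2 μ} {g : Lp E 2 μ} (h : Tendsto f atTop (𝓝 g)) :
    ∃ ns : ℕ → ℕ, StrictMono ns ∧ ∀ᵐ x ∂μ, Tendsto (fun n => f (ns n) x) atTop (𝓝 (g x)) :=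
  (tendstoInMeasure_of_tendsto_Lp h).exists_seq_tendsto_ae

/-- Approximate `u` and `v` by test functions, whose smooth norms are again test functions. Since `ε
> 0`, all coefficients are continuous in the values of the two functions and bounded by 1, so a.e.
convergence along a subsequence suffices to pass to the limit in both components. -/
theorem W012.exists_smoothNorm {ε : ℝ} (hε : 0 < ε) (u v : W012 Ω) :
    ∃ z : W012 Ω, W012.fn z =ᵐ[volume.restrict Ω]
        (fun x => smoothNorm ε (W012.fn u x) (W012.fn v x)) ∧
      W012.grad z =ᵐ[volume.restrict Ω] fun x =>
        (W012.fn u x / √(W012.fn u x ^ 2 + W012.fn v x ^ 2 + ε ^ 2)) • W012.grad u x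
        + (W012.fn v x / √(W012.fn u x ^ 2 + W012.fn v x ^ 2 + ε ^ 2)) • W012.grad v x := by
  obtain ⟨U₀, hU₀, hU₀lim⟩ := mem_closure_iff_seq_limit.1 u.2
  obtain ⟨V₀, hV₀, hV₀lim⟩ := mem_closure_iff_seq_limit.1 v.2
  -- The extraction `ns` gives a.e. convergence to `u`; refining it by `ms` gives a.e. convergence
  -- to `v` as well.
  obtain ⟨ns, hns, hae₁⟩ := Lp.exists_subseq_tendsto_ae ((continuous_fst.tendsto _).comp hU₀lim)
  obtain ⟨ms, hms, hae₂⟩ := Lp.exists_subseq_tendsto_ae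
    (((continuous_fst.tendsto _).comp hV₀lim).comp hns.tendsto_atTop)
  obtain ⟨U, V, hU, hV, hUlim, hVlim, hUae, hVae⟩ : ∃ U V : ℕ → L2Fun Ω × L2Vec Ω,
      (∀ n, U n ∈ testGraph Ω) ∧ (∀ n, V n ∈ testGraph Ω) ∧
      Tendsto U atTop (𝓝 u.1) ∧ Tendsto V atTop (𝓝 v.1) ∧
      (∀ᵐ x ∂(volume.restrict Ω), Tendsto (fun n => (U n).1 x) atTop (𝓝 (W012.fn u x))) ∧
      (∀ᵐ x ∂(volume.restrict Ω), Tendsto (fun n => (V n).1 x) atTop (𝓝 (W012.fn v x))) :=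
    ⟨fun n => U₀ (ns (ms n)), fun n => V₀ (ns (ms n)), fun n => hU₀ _, fun n => hV₀ _,
      hU₀lim.comp (hns.tendsto_atTop.comp hms.tendsto_atTop),
      hV₀lim.comp (hns.tendsto_atTop.comp hms.tendsto_atTop),
      hae₁.mono fun x hx => hx.comp hms.tendsto_atTop, hae₂⟩
  choose f hf hfU hfU' using hU
  choose g hg hgV hgV' using hV
  have hz := fun n => (hf n).smoothNorm hε (hg n)
  let Z : ℕ → L2Fun Ω × L2Vec Ω := fun n => ((hz n).memLp.toLp, (hz n).memLp_gradient.toLp)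
  have hZ : ∀ n, Z n ∈ testGraph Ω := fun n =>
    ⟨_, hz n, (hz n).memLp.coeFn_toLp, (hz n).memLp_gradient.coeFn_toLp⟩
  let S : ℝ → ℝ → ℝ := fun a b => √(a ^ 2 + b ^ 2 + ε ^ 2)
  have hSc : Continuous fun p : ℝ × ℝ => S p.1 p.2 := by fun_prop
  have hSpos : ∀ a b, 0 < S a b := sqrt_add_sq_pos hε
  have hc₁ : Continuous fun p : ℝ × ℝ => p.1 / S p.1 p.2 :=
    continuous_fst.div hSc fun p => (hSpos _ _).ne'
  have hc₂ : Continuous fun p : ℝ × ℝ => p.2 / S p.1 p.2 :=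
    continuous_snd.div hSc fun p => (hSpos _ _).ne'
  have hc₃ : Continuous fun p : ℝ × ℝ => p.1 / (S p.1 p.2 + ε) :=
    continuous_fst.div (hSc.add continuous_const) fun p => (add_pos (hSpos _ _) hε).ne'
  have hc₄ : Continuous fun p : ℝ × ℝ => p.2 / (S p.1 p.2 + ε) :=
    continuous_snd.div (hSc.add continuous_const) fun p => (add_pos (hSpos _ _) hε).ne'
  have hb₁ : ∀ a b, |a / S a b| ≤ 1 := fun a b =>
    abs_div_le_one_of_abs_le (abs_le_sqrt_add_sq a b ε)
  have hb₂ : ∀ a b, |b / S a b| ≤ 1 := fun a b =>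
    abs_div_le_one_of_abs_le (abs_le_sqrt_add_sq' a b ε)
  have hb₃ : ∀ a b, |a / (S a b + ε)| ≤ 1 := fun a b =>
    abs_div_le_one_of_abs_le ((abs_le_sqrt_add_sq a b ε).trans (by linarith))
  have hb₄ : ∀ a b, |b / (S a b + ε)| ≤ 1 := fun a b =>
    abs_div_le_one_of_abs_le ((abs_le_sqrt_add_sq' a b ε).trans (by linarith))
  have hm : ∀ {c : ℝ × ℝ → ℝ} (_ : Continuous c) (P Q : L2Fun Ω),
      AEStronglyMeasurable (fun x => c (P x, Q x)) (volume.restrict Ω) := fun hc P Q =>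
    hc.comp_aestronglyMeasurable
      ((Lp.aestronglyMeasurable P).prodMk (Lp.aestronglyMeasurable Q))
  have hl : ∀ {c : ℝ × ℝ → ℝ} (_ : Continuous c), ∀ᵐ x ∂(volume.restrict Ω),
      Tendsto (fun n => c ((U n).1 x, (V n).1 x)) atTop (𝓝 (c (W012.fn u x, W012.fn v x))) := by
    intro c hc
    filter_upwards [hUae, hVae] with x h1 h2
    exact (hc.tendsto _).comp (h1.prodMk_nhds h2)
  have hM₁ := Lp.memLp_smul_add_smul (W012.fn u) (W012.fn v) (hm hc₃ (W012.fn u) (W012.fn v))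
    (hm hc₄ (W012.fn u) (W012.fn v)) (fun x => hb₃ _ _) (fun x => hb₄ _ _)
  have hM₂ := Lp.memLp_smul_add_smul (W012.grad u) (W012.grad v) (hm hc₁ (W012.fn u) (W012.fn v))
    (hm hc₂ (W012.fn u) (W012.fn v)) (fun x => hb₁ _ _) (fun x => hb₂ _ _)
  have hlim₁ : Tendsto (fun n => (Z n).1) atTop (𝓝 hM₁.toLp) := by
    refine Lp.tendsto_of_tendsto_smul_add_smul (F := fun n => (U n).1) (H := fun n => (V n).1)
      (a := fun n x => (U n).1 x / (S ((U n).1 x) ((V n).1 x) + ε))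
      (b := fun n x => (V n).1 x / (S ((U n).1 x) ((V n).1 x) + ε))
      (fun n => ?_) hM₁.coeFn_toLp (fun n => hm hc₃ _ _) (fun n => hm hc₄ _ _)
      (fun n x => hb₃ _ _) (fun n x => hb₄ _ _) (hm hc₃ (W012.fn u) (W012.fn v))
      (fun x => hb₃ _ _) (hl hc₃) (hl hc₄)
      ((continuous_fst.tendsto _).comp hUlim) ((continuous_fst.tendsto _).comp hVlim)
    filter_upwards [(hz n).memLp.coeFn_toLp, hfU n, hgV n] with x h1 h2 h3
    rw [h1, h2, h3, smoothNorm_eq hε]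
    rfl
  have hlim₂ : Tendsto (fun n => (Z n).2) atTop (𝓝 hM₂.toLp) := by
    refine Lp.tendsto_of_tendsto_smul_add_smul (F := fun n => (U n).2) (H := fun n => (V n).2)
      (a := fun n x => (U n).1 x / S ((U n).1 x) ((V n).1 x))
      (b := fun n x => (V n).1 x / S ((U n).1 x) ((V n).1 x))
      (fun n => ?_) hM₂.coeFn_toLp (fun n => hm hc₁ _ _) (fun n => hm hc₂ _ _)
      (fun n x => hb₁ _ _) (fun n x => hb₂ _ _) (hm hc₁ (W012.fn u) (W012.fn v))
      (fun x => hb₁ _ _) (hl hc₁) (hl hc₂)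
      ((continuous_snd.tendsto _).comp hUlim) ((continuous_snd.tendsto _).comp hVlim)
    filter_upwards [(hz n).memLp_gradient.coeFn_toLp, hfU n, hgV n, hfU' n, hgV' n]
      with x h1 h2 h3 h4 h5
    rw [h1, h2, h3, h4, h5, gradient_smoothNorm hε ((hf n).1.differentiable (by simp) x)
      ((hg n).1.differentiable (by simp) x)]
  refine ⟨⟨(hM₁.toLp, hM₂.toLp), mem_closure_of_tendsto (hlim₁.prodMk_nhds hlim₂)
    (.of_forall hZ)⟩, ?_, hM₂.coeFn_toLp⟩
  refine hM₁.coeFn_toLp.trans (.of_forall fun x => ?_)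
  exact (smoothNorm_eq hε _ _).symm

/-- `√(u² + v²)` belongs to `W₀^{1,2}(Ω)`, and its gradient vanishes where `u = v = 0`. -/
theorem W012.exists_sqrt_sq_add_sq (u v : W012 Ω) :
    ∃ z : W012 Ω, W012.fn z =ᵐ[volume.restrict Ω]
        (fun x => √(W012.fn u x ^ 2 + W012.fn v x ^ 2)) ∧
      W012.grad z =ᵐ[volume.restrict Ω] fun x =>
        (W012.fn u x / √(W012.fn u x ^ 2 + W012.fn v x ^ 2)) • W012.grad u x
        + (W012.fn v x / √(W012.fn u x ^ 2 + W012.fn v x ^ 2)) • W012.grad v x := by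
  have hε : ∀ n : ℕ, (0 : ℝ) < 1 / ((n : ℝ) + 1) := fun n => Nat.one_div_pos_of_nat
  choose z hz hz' using fun n => W012.exists_smoothNorm (hε n) u v
  have hεlim : Tendsto (fun n : ℕ => 1 / ((n : ℝ) + 1)) atTop (𝓝 0) :=
    tendsto_one_div_add_atTop_nhds_zero_nat
  have hS : ∀ a b : ℝ, Tendsto (fun n : ℕ => √(a ^ 2 + b ^ 2 + (1 / ((n : ℝ) + 1)) ^ 2)) atTop
      (𝓝 (√(a ^ 2 + b ^ 2))) := fun a b => by
    have := ((hεlim.pow 2).const_add (a ^ 2 + b ^ 2)).sqrt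
    simpa using this
  have hbd : ∀ a b s : ℝ, √(a ^ 2 + b ^ 2 + s ^ 2) ≤ |a| + |b| + |s| := fun a b s =>
    Real.sqrt_le_iff.2 ⟨by positivity, by
      rw [← sq_abs a, ← sq_abs b, ← sq_abs s]
      nlinarith [abs_nonneg a, abs_nonneg b, abs_nonneg s,
        mul_nonneg (abs_nonneg a) (abs_nonneg b), mul_nonneg (abs_nonneg a) (abs_nonneg s),
        mul_nonneg (abs_nonneg b) (abs_nonneg s)]⟩
  have hmu := Lp.aestronglyMeasurable (W012.fn u)
  have hmv := Lp.aestronglyMeasurable (W012.fn v)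
  have hmS : AEMeasurable (fun x => √(W012.fn u x ^ 2 + W012.fn v x ^ 2))
      (volume.restrict Ω) :=
    ((hmu.aemeasurable.pow_const 2).add (hmv.aemeasurable.pow_const 2)).sqrt
  have hM₁ : MemLp (fun x => √(W012.fn u x ^ 2 + W012.fn v x ^ 2)) 2 (volume.restrict Ω) :=
    ((Lp.memLp (W012.fn u)).norm.add (Lp.memLp (W012.fn v)).norm).mono'
      hmS.aestronglyMeasurable (.of_forall fun x => by
        rw [Real.norm_of_nonneg (Real.sqrt_nonneg _)]
        simpa using hbd (W012.fn u x) (W012.fn v x) 0)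
  have hM₂ := Lp.memLp_smul_add_smul (W012.grad u) (W012.grad v)
    (hmu.aemeasurable.div hmS).aestronglyMeasurable (hmv.aemeasurable.div hmS).aestronglyMeasurable
    (fun x => abs_div_le_one_of_abs_le (by
      simpa using abs_le_sqrt_add_sq (W012.fn u x) (W012.fn v x) 0))
    (fun x => abs_div_le_one_of_abs_le (by
      simpa using abs_le_sqrt_add_sq' (W012.fn u x) (W012.fn v x) 0))
  have hlim₁ : Tendsto (fun n => W012.fn (z n)) atTop (𝓝 hM₁.toLp) := by
    refine Lp.tendsto_of_dominated hz hM₁.coeFn_toLp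
      ((Lp.memLp (W012.fn u)).norm.add (Lp.memLp (W012.fn v)).norm)
      (fun n => .of_forall fun x => ?_) (.of_forall fun x => ?_)
    · have h1 := hbd (W012.fn u x) (W012.fn v x) (1 / ((n : ℝ) + 1))
      -- With `ε` in the first slot this reads `ε ≤ √(u² + v² + ε²)`, so the smooth norm is
      -- nonnegative.
      have h2 := abs_le_sqrt_add_sq (1 / ((n : ℝ) + 1)) (W012.fn u x) (W012.fn v x)
      rw [abs_of_pos (hε n)] at h1 h2
      rw [add_comm (_ ^ 2) (W012.fn u x ^ 2), add_right_comm] at h2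
      rw [smoothNorm, Real.norm_of_nonneg (by linarith)]
      simp only [Pi.add_apply, Real.norm_eq_abs]
      linarith
    · simpa [smoothNorm] using (hS (W012.fn u x) (W012.fn v x)).sub hεlim
  have hlim₂ : Tendsto (fun n => W012.grad (z n)) atTop (𝓝 hM₂.toLp) := by
    refine Lp.tendsto_of_dominated hz' hM₂.coeFn_toLp
      ((Lp.memLp (W012.grad u)).norm.add (Lp.memLp (W012.grad v)).norm)
      (fun n => .of_forall fun x => ?_) (.of_forall fun x => ?_)
    · refine (norm_add_le _ _).trans (add_le_add ?_ ?_) <;> rw [norm_smul]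
      · exact mul_le_of_le_one_left (norm_nonneg _)
          (abs_div_le_one_of_abs_le (abs_le_sqrt_add_sq _ _ _))
      · exact mul_le_of_le_one_left (norm_nonneg _)
          (abs_div_le_one_of_abs_le (abs_le_sqrt_add_sq' _ _ _))
    -- Where `u = v = 0` the approximating gradients vanish for every `ε`, and so does the limit
    -- formula, by the convention `0 / 0 = 0`. Elsewhere the denominators converge to a nonzero
    -- limit.
    · rcases eq_or_ne (√(W012.fn u x ^ 2 + W012.fn v x ^ 2)) 0 with h0 | h0
      · have h1 : W012.fn u x = 0 := abs_nonpos_iff.1 <| by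
          simpa [h0] using abs_le_sqrt_add_sq (W012.fn u x) (W012.fn v x) 0
        have h2 : W012.fn v x = 0 := abs_nonpos_iff.1 <| by
          simpa [h0] using abs_le_sqrt_add_sq' (W012.fn u x) (W012.fn v x) 0
        simp [h1, h2]
      · exact ((tendsto_const_nhds.div (hS _ _) h0).smul_const _).add
          ((tendsto_const_nhds.div (hS _ _) h0).smul_const _)
  exact ⟨⟨(hM₁.toLp, hM₂.toLp), (testGraph Ω).isClosed_topologicalClosure.mem_of_tendsto
    (hlim₁.prodMk_nhds hlim₂) (.of_forall fun n => (z n).2)⟩, hM₁.coeFn_toLp, hM₂.coeFn_toLp⟩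

end

/-! ### Positive parts and the segment from `φ⁺` to `φ`. -/

section

variable {N : ℕ} {Ω : Set (EuclideanSpace ℝ (Fin N))}

theorem W012.coeFn_fn_smul (c : ℝ) (u : W012 Ω) :
    W012.fn (c • u) =ᵐ[volume.restrict Ω] fun x => c * W012.fn u x :=
  Lp.coeFn_smul c (W012.fn u)

theorem W012.coeFn_grad_smul (c : ℝ) (u : W012 Ω) :
    W012.grad (c • u) =ᵐ[volume.restrict Ω] fun x => c • W012.grad u x :=
  Lp.coeFn_smul c (W012.grad u)

theorem W012.coeFn_fn_sub (u v : W012 Ω) :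
    W012.fn (u - v) =ᵐ[volume.restrict Ω] fun x => W012.fn u x - W012.fn v x :=
  Lp.coeFn_sub (W012.fn u) (W012.fn v)

theorem W012.coeFn_grad_sub (u v : W012 Ω) :
    W012.grad (u - v) =ᵐ[volume.restrict Ω] fun x => W012.grad u x - W012.grad v x :=
  Lp.coeFn_sub (W012.grad u) (W012.grad v)

/-- The absolute value of an element of `W₀^{1,2}(Ω)`. -/
theorem W012.exists_abs (u : W012 Ω) :
    ∃ z : W012 Ω, W012.fn z =ᵐ[volume.restrict Ω] (fun x => |W012.fn u x|) ∧
      W012.grad z =ᵐ[volume.restrict Ω] fun x =>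
        (W012.fn u x / |W012.fn u x|) • W012.grad u x := by
  obtain ⟨z, hz, hz'⟩ := W012.exists_sqrt_sq_add_sq u 0
  have h0 : W012.fn (0 : W012 Ω) =ᵐ[volume.restrict Ω] 0 := Lp.coeFn_zero _ _ _
  refine ⟨z, ?_, ?_⟩
  · filter_upwards [hz, h0] with x h1 h2
    simp [h1, h2, Real.sqrt_sq_eq_abs]
  · filter_upwards [hz', h0] with x h1 h2
    simp [h1, h2, Real.sqrt_sq_eq_abs]

theorem W012.exists_posPart (u : W012 Ω) :
    ∃ p : W012 Ω, W012.fn p = Lp.posPart (W012.fn u) := by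
  obtain ⟨z, hz, -⟩ := W012.exists_abs u
  refine ⟨(1 / 2 : ℝ) • (u + z), Lp.ext ?_⟩
  have hadd : W012.fn (u + z) =ᵐ[volume.restrict Ω] fun x => W012.fn u x + W012.fn z x :=
    Lp.coeFn_add (W012.fn u) (W012.fn z)
  filter_upwards [W012.coeFn_fn_smul (1 / 2) (u + z), hadd, hz,
    Lp.coeFn_posPart (W012.fn u)] with x h1 h2 h3 h4
  rw [h1, h2, h3, h4]
  rcases le_total 0 (W012.fn u x) with h | h
  · rw [abs_of_nonneg h, max_eq_left h]
    ring
  · rw [abs_of_nonpos h, max_eq_right h]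
    ring

/-- Since `u = |u|` and the function determines its weak gradient, `∇u` is given by the formula of
`W012.exists_abs`, whose coefficient `u / |u|` is zero where `u = 0`. -/
theorem W012.grad_eq_zero_of_fn_eq_zero (hΩ : IsOpen Ω) {u : W012 Ω}
    (hu : ∀ᵐ x ∂(volume.restrict Ω), 0 ≤ W012.fn u x) :
    ∀ᵐ x ∂(volume.restrict Ω), W012.fn u x = 0 → W012.grad u x = 0 := by
  obtain ⟨z, hz, hz'⟩ := W012.exists_abs u
  have hzu : z = u := W012.ext_fn hΩ <| Lp.ext <| by
    filter_upwards [hz, hu] with x h1 h2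
    rw [h1, abs_of_nonneg h2]
  subst hzu
  filter_upwards [hz'] with x h1 h2
  rw [h1, h2]
  simp

theorem W012.integrable_norm_grad_sq (u : W012 Ω) :
    Integrable (fun x => ‖W012.grad u x‖ ^ 2) (volume.restrict Ω) :=
  (Lp.memLp (W012.grad u)).integrable_norm_pow (by norm_num)

theorem W012.integrable_abs_fn_rpow (hΩ : Bornology.IsBounded Ω) {q : ℝ} (hq₀ : 0 ≤ q)
    (hq₂ : q ≤ 2) (u : W012 Ω) :
    Integrable (fun x => |W012.fn u x| ^ q) (volume.restrict Ω) := by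
  have : IsFiniteMeasure (volume.restrict Ω) :=
    isFiniteMeasure_restrict.2 hΩ.measure_lt_top.ne
  have h : MemLp (W012.fn u) (ENNReal.ofReal q) (volume.restrict Ω) :=
    (Lp.memLp (W012.fn u)).mono_exponent (by
      rw [← ENNReal.ofReal_ofNat]
      exact ENNReal.ofReal_le_ofReal hq₂)
  simpa [ENNReal.toReal_ofReal hq₀] using h.integrable_norm_rpow'

/-- With `m = p - u` the negative part, the energy of `p - t m` is `F(p) + A t² - B t^q`, which is
at most `F(p) + (A - B) t^q` on `[0, 1]`. As `t^q` lies in `[0, 1]`, the sign of `A - B` decides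
which endpoint dominates. -/
theorem W012.joinedIn_posPart (hΩ : IsOpen Ω) (hΩb : Bornology.IsBounded Ω) {q α : ℝ}
    (hq₁ : 1 < q) (hq₂ : q < 2) {p u : W012 Ω}
    (hp : W012.fn p = Lp.posPart (W012.fn u)) :
    JoinedIn {v : W012 Ω | energy q α v ≤ max (energy q α p) (energy q α u)} p u := by
  obtain ⟨m, hm⟩ : ∃ m, m = p - u := ⟨_, rfl⟩
  have hpm : ∀ᵐ x ∂(volume.restrict Ω), 0 ≤ W012.fn p x ∧ 0 ≤ W012.fn m x ∧
      (W012.fn p x = 0 ∨ W012.fn m x = 0) := by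
    filter_upwards [W012.coeFn_fn_sub p u, Lp.coeFn_posPart (W012.fn u)] with x h1 h2
    rw [hm, h1, hp, h2]
    rcases le_total 0 (W012.fn u x) with h | h
    · simp [h]
    · simp [h]
  have hgp := W012.grad_eq_zero_of_fn_eq_zero hΩ (hpm.mono fun x h => h.1)
  have hgm := W012.grad_eq_zero_of_fn_eq_zero hΩ (hpm.mono fun x h => h.2.1)
  have hE : ∀ t : ℝ, 0 ≤ t → energy q α (p - t • m) = energy q α p
      + (1 / 2 * (∫ x in Ω, ‖W012.grad m x‖ ^ 2) * t ^ 2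
        - α / q * (∫ x in Ω, |W012.fn m x| ^ q) * t ^ q) := by
    intro t ht
    -- No cross term: at almost every point `p` or `m` vanishes, and its gradient vanishes there
    -- too.
    have h1 : ∫ x in Ω, ‖W012.grad (p - t • m) x‖ ^ 2
        = (∫ x in Ω, ‖W012.grad p x‖ ^ 2) + t ^ 2 * ∫ x in Ω, ‖W012.grad m x‖ ^ 2 := by
      rw [← integral_const_mul, ← integral_add (W012.integrable_norm_grad_sq p)
        ((W012.integrable_norm_grad_sq m).const_mul _)]
      refine integral_congr_ae ?_
      filter_upwards [W012.coeFn_grad_sub p (t • m), W012.coeFn_grad_smul t m, hpm, hgp, hgm]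
        with x h1 h2 h3 h4 h5
      simp only [h1, h2]
      rcases h3.2.2 with h | h
      · simp [h4 h, norm_smul, mul_pow]
      · simp [h5 h]
    have h2 : ∫ x in Ω, |W012.fn (p - t • m) x| ^ q
        = (∫ x in Ω, |W012.fn p x| ^ q) + t ^ q * ∫ x in Ω, |W012.fn m x| ^ q := by
      rw [← integral_const_mul, ← integral_add
        (W012.integrable_abs_fn_rpow hΩb (by linarith) hq₂.le p)
        ((W012.integrable_abs_fn_rpow hΩb (by linarith) hq₂.le m).const_mul _)]
      refine integral_congr_ae ?_
      filter_upwards [W012.coeFn_fn_sub p (t • m), W012.coeFn_fn_smul t m, hpm]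
        with x h1 h2 h3
      have hq : q ≠ 0 := by linarith
      simp only [h1, h2]
      rcases h3.2.2 with h | h
      · simp [h, Real.zero_rpow hq, abs_mul, abs_of_nonneg ht, Real.mul_rpow ht (abs_nonneg _)]
      · simp [h, Real.zero_rpow hq]
    rw [energy, energy, h1, h2]
    ring
  have hA : 0 ≤ 1 / 2 * (∫ x in Ω, ‖W012.grad m x‖ ^ 2) := by positivity
  -- At `t = 1` the expansion becomes `F(u) = F(p) + A - B`.
  have hu := hE 1 zero_le_one
  rw [one_smul, Real.one_rpow, one_pow, mul_one, mul_one,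
    show p - m = u by rw [hm, sub_sub_cancel]] at hu
  refine JoinedIn.ofLine (f := fun t : ℝ => p - t • m)
    (by fun_prop) (by simp) (by simp [hm]) ?_
  rintro _ ⟨t, ⟨ht0, ht1⟩, rfl⟩
  rw [Set.mem_ofPred_eq, hE t ht0, hu]
  generalize 1 / 2 * (∫ x in Ω, ‖W012.grad m x‖ ^ 2) = A at hA ⊢
  generalize α / q * (∫ x in Ω, |W012.fn m x| ^ q) = B
  have htq : t ^ 2 ≤ t ^ q := by
    rcases ht0.eq_or_lt with rfl | h
    · simp [Real.zero_rpow (show q ≠ 0 by linarith)]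
    · rw [← Real.rpow_two]
      exact Real.rpow_le_rpow_of_exponent_ge h ht1 hq₂.le
  have htq1 : t ^ q ≤ 1 := Real.rpow_le_one ht0 ht1 (by linarith)
  have htq0 : 0 ≤ t ^ q := Real.rpow_nonneg ht0 q
  have h1 : A * t ^ 2 ≤ A * t ^ q := mul_le_mul_of_nonneg_left htq hA
  rcases le_total A B with h | h
  · exact le_max_of_le_left (by nlinarith)
  · exact le_max_of_le_right (by nlinarith)

/-! ### Hidden convexity and the path from `w` to `φ⁺`. -/

/-- Cauchy–Schwarz with weights `1 - t` and `t`; the defect is `t (1 - t) (a y - b x)²`. If the root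
vanishes, both quotients are zero by convention. -/
theorem sq_smul_div_sqrt_le {t a b x y : ℝ} (ht0 : 0 ≤ t) (ht1 : t ≤ 1) :
    ((1 - t) * a / √((1 - t) * a ^ 2 + t * b ^ 2) * x
        + t * b / √((1 - t) * a ^ 2 + t * b ^ 2) * y) ^ 2
      ≤ (1 - t) * x ^ 2 + t * y ^ 2 := by
  have h1 : 0 ≤ 1 - t := sub_nonneg.2 ht1
  have hR : 0 ≤ (1 - t) * x ^ 2 + t * y ^ 2 := by positivity
  rcases (Real.sqrt_nonneg ((1 - t) * a ^ 2 + t * b ^ 2)).eq_or_lt with h | h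
  · rw [← h]
    simpa using hR
  · have hs := Real.sq_sqrt (show 0 ≤ (1 - t) * a ^ 2 + t * b ^ 2 by positivity)
    rw [div_mul_eq_mul_div, div_mul_eq_mul_div, ← add_div, div_pow, div_le_iff₀ (by positivity),
      hs]
    nlinarith [mul_nonneg (mul_nonneg ht0 h1) (sq_nonneg (a * y - b * x))]

/-- For `a > 0` the denominator vanishes only when `b = 0` and `t = 1`. In the case `b = 0` the
first quotient is `√(1 - t)`, including at `t = 1`, and the second is zero. This gives continuity of
the gradients along the path up to its endpoint. -/
theorem continuous_mul_div_sqrt {a b : ℝ} (ha : 0 < a) (hb : 0 ≤ b) :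
    (Continuous fun t : unitInterval =>
      (1 - (t : ℝ)) * a / √((1 - (t : ℝ)) * a ^ 2 + t * b ^ 2)) ∧
    (Continuous fun t : unitInterval =>
      (t : ℝ) * b / √((1 - (t : ℝ)) * a ^ 2 + t * b ^ 2)) := by
  rcases hb.eq_or_lt with rfl | hb
  · have h : ∀ t : unitInterval, (1 - (t : ℝ)) * a / √((1 - (t : ℝ)) * a ^ 2 + t * 0 ^ 2)
        = √(1 - (t : ℝ)) := fun t => by
      have ht : 0 ≤ 1 - (t : ℝ) := sub_nonneg.2 t.2.2
      rw [zero_pow two_ne_zero, mul_zero, add_zero, Real.sqrt_mul ht, Real.sqrt_sq ha.le,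
        mul_div_mul_right _ _ ha.ne', Real.div_sqrt]
    refine ⟨?_, ?_⟩
    · simp only [h]
      fun_prop
    · simpa using continuous_const
  · have h : ∀ t : unitInterval, √((1 - (t : ℝ)) * a ^ 2 + t * b ^ 2) ≠ 0 := fun t => by
      refine (Real.sqrt_pos.2 ?_).ne'
      have ht : 0 ≤ 1 - (t : ℝ) := sub_nonneg.2 t.2.2
      rcases t.2.1.eq_or_lt with h0 | h0
      · rw [← h0]
        simpa using pow_pos ha 2
      · positivity
    exact ⟨Continuous.div (by fun_prop) (by fun_prop) h,
      Continuous.div (by fun_prop) (by fun_prop) h⟩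

theorem W012.exists_sqrt_convexCombination (w p : W012 Ω) {t : ℝ} (ht0 : 0 ≤ t) (ht1 : t ≤ 1) :
    ∃ z : W012 Ω, W012.fn z =ᵐ[volume.restrict Ω]
        (fun x => √((1 - t) * W012.fn w x ^ 2 + t * W012.fn p x ^ 2)) ∧
      W012.grad z =ᵐ[volume.restrict Ω] fun x =>
        ((1 - t) * W012.fn w x / √((1 - t) * W012.fn w x ^ 2 + t * W012.fn p x ^ 2))
          • W012.grad w x
        + (t * W012.fn p x / √((1 - t) * W012.fn w x ^ 2 + t * W012.fn p x ^ 2))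
          • W012.grad p x := by
  obtain ⟨z, hz, hz'⟩ := W012.exists_sqrt_sq_add_sq (√(1 - t) • w) (√t • p)
  have hs := Real.sq_sqrt ht0
  have hs' := Real.sq_sqrt (sub_nonneg.2 ht1)
  refine ⟨z, ?_, ?_⟩
  · filter_upwards [hz, W012.coeFn_fn_smul (√(1 - t)) w, W012.coeFn_fn_smul (√t) p]
      with x h1 h2 h3
    rw [h1, h2, h3, mul_pow, mul_pow, hs, hs']
  · filter_upwards [hz', W012.coeFn_fn_smul (√(1 - t)) w, W012.coeFn_fn_smul (√t) p,
      W012.coeFn_grad_smul (√(1 - t)) w, W012.coeFn_grad_smul (√t) p] with x h1 h2 h3 h4 h5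
    rw [h1, h2, h3, h4, h5, mul_pow, mul_pow, hs, hs', smul_smul, smul_smul]
    congr 2
    · rw [div_mul_eq_mul_div, mul_right_comm, ← sq, hs']
    · rw [div_mul_eq_mul_div, mul_right_comm, ← sq, hs]

/-- Hidden convexity: the energy is convex along `t ↦ √((1 - t) w² + t p²)`. -/
theorem energy_le_of_sqrt_convexCombination (hΩb : Bornology.IsBounded Ω) {q α : ℝ}
    (hq₁ : 1 < q) (hq₂ : q < 2) (hα : 0 < α) {w p z : W012 Ω} {t : ℝ} (ht0 : 0 ≤ t) (ht1 : t ≤ 1)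
    (hw : ∀ᵐ x ∂(volume.restrict Ω), 0 ≤ W012.fn w x)
    (hp : ∀ᵐ x ∂(volume.restrict Ω), 0 ≤ W012.fn p x)
    (hz : W012.fn z =ᵐ[volume.restrict Ω]
        (fun x => √((1 - t) * W012.fn w x ^ 2 + t * W012.fn p x ^ 2)))
    (hz' : W012.grad z =ᵐ[volume.restrict Ω] fun x =>
        ((1 - t) * W012.fn w x / √((1 - t) * W012.fn w x ^ 2 + t * W012.fn p x ^ 2))
          • W012.grad w x
        + (t * W012.fn p x / √((1 - t) * W012.fn w x ^ 2 + t * W012.fn p x ^ 2))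
          • W012.grad p x) :
    energy q α z ≤ (1 - t) * energy q α w + t * energy q α p := by
  have h1t : 0 ≤ 1 - t := sub_nonneg.2 ht1
  have h1 : ∫ x in Ω, ‖W012.grad z x‖ ^ 2 ≤ (1 - t) * (∫ x in Ω, ‖W012.grad w x‖ ^ 2)
      + t * ∫ x in Ω, ‖W012.grad p x‖ ^ 2 := by
    rw [← integral_const_mul, ← integral_const_mul, ← integral_add
      ((W012.integrable_norm_grad_sq w).const_mul _)
      ((W012.integrable_norm_grad_sq p).const_mul _)]
    refine integral_mono_ae (W012.integrable_norm_grad_sq z)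
      (((W012.integrable_norm_grad_sq w).const_mul _).add
      ((W012.integrable_norm_grad_sq p).const_mul _)) ?_
    filter_upwards [hz', hw, hp] with x h1 h2 h3
    simp only [h1]
    refine le_trans ?_ (sq_smul_div_sqrt_le (a := W012.fn w x) (b := W012.fn p x) ht0 ht1)
    refine pow_le_pow_left₀ (norm_nonneg _) ((norm_add_le _ _).trans_eq ?_) 2
    rw [norm_smul, norm_smul, Real.norm_of_nonneg (by positivity),
      Real.norm_of_nonneg (by positivity)]
  have h2 : (1 - t) * (∫ x in Ω, |W012.fn w x| ^ q) + t * (∫ x in Ω, |W012.fn p x| ^ q)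
      ≤ ∫ x in Ω, |W012.fn z x| ^ q := by
    have hi := W012.integrable_abs_fn_rpow hΩb (by linarith) hq₂.le (Ω := Ω)
    rw [← integral_const_mul, ← integral_const_mul, ← integral_add
      ((hi w).const_mul _) ((hi p).const_mul _)]
    refine integral_mono_ae (((hi w).const_mul _).add ((hi p).const_mul _)) (hi z) ?_
    filter_upwards [hz, hw, hp] with x h1 h2 h3
    -- Concavity of `s ↦ s^(q/2)`, applied to the squares of `w` and `p`.
    have hc := (Real.concaveOn_rpow (show 0 ≤ q / 2 by linarith) (by linarith)).2
      (Set.mem_Ici.2 (sq_nonneg (W012.fn w x))) (Set.mem_Ici.2 (sq_nonneg (W012.fn p x)))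
      h1t ht0 (sub_add_cancel 1 t)
    have hpow : ∀ a : ℝ, 0 ≤ a → (a ^ 2) ^ (q / 2) = a ^ q := fun a ha => by
      rw [← Real.rpow_natCast_mul ha]
      congr 1
      push_cast
      ring
    simp only [smul_eq_mul, hpow _ h2, hpow _ h3] at hc
    simp only [h1, abs_of_nonneg h2, abs_of_nonneg h3, abs_of_nonneg (Real.sqrt_nonneg _)]
    refine hc.trans_eq ?_
    rw [← hpow _ (Real.sqrt_nonneg _), Real.sq_sqrt (by positivity)]
  have hαq : 0 ≤ α / q := by positivity
  have := mul_le_mul_of_nonneg_left h2 hαq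
  rw [energy, energy, energy]
  linarith

/-- Strong continuity of `t ↦ √((1 - t) w² + t p²)` comes from dominated convergence: the
coefficients of `∇w` and `∇p` are bounded by 1 and, since `w > 0` a.e., continuous in `t` at almost
every point. The endpoints need only be identified as functions, by `W012.ext_fn`. -/
theorem W012.exists_path_energy_le (hΩ : IsOpen Ω) (hΩb : Bornology.IsBounded Ω) {q α : ℝ}
    (hq₁ : 1 < q) (hq₂ : q < 2) (hα : 0 < α) {w p : W012 Ω}
    (hw : ∀ᵐ x ∂(volume.restrict Ω), 0 < W012.fn w x)
    (hp : ∀ᵐ x ∂(volume.restrict Ω), 0 ≤ W012.fn p x) :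
    ∃ γ : Path w p, ∀ t : unitInterval,
      energy q α (γ t) ≤ (1 - (t : ℝ)) * energy q α w + t * energy q α p := by
  choose z hz hz' using fun t : unitInterval =>
    W012.exists_sqrt_convexCombination w p t.2.1 t.2.2
  -- The bounds on the coefficients follow from `(1 - t)² ≤ 1 - t` and `t² ≤ t`.
  have hb : ∀ (t : unitInterval) (a b : ℝ),
      |(1 - (t : ℝ)) * a| ≤ √((1 - (t : ℝ)) * a ^ 2 + t * b ^ 2) ∧
      |(t : ℝ) * b| ≤ √((1 - (t : ℝ)) * a ^ 2 + t * b ^ 2) := by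
    rintro ⟨t, ht0, ht1⟩ a b
    have h1 : 0 ≤ 1 - t := sub_nonneg.2 ht1
    have h2 := mul_nonneg (mul_nonneg ht0 h1) (sq_nonneg a)
    have h3 := mul_nonneg (mul_nonneg ht0 h1) (sq_nonneg b)
    have h4 := mul_nonneg ht0 (sq_nonneg b)
    have h5 := mul_nonneg h1 (sq_nonneg a)
    exact ⟨Real.abs_le_sqrt (by simp only; nlinarith), Real.abs_le_sqrt (by simp only; nlinarith)⟩
  have hfn : Continuous fun t => W012.fn (z t) := continuous_iff_continuousAt.2 fun t => by
    refine Lp.tendsto_of_dominated hz (hz t)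
      ((Lp.memLp (W012.fn w)).norm.add (Lp.memLp (W012.fn p)).norm)
      (fun s => .of_forall fun x => ?_) (.of_forall fun x => ?_)
    · rw [Real.norm_of_nonneg (Real.sqrt_nonneg _)]
      refine Real.sqrt_le_iff.2 ⟨by simp only [Pi.add_apply]; positivity, ?_⟩
      simp only [Pi.add_apply, Real.norm_eq_abs]
      rw [← sq_abs (W012.fn w x), ← sq_abs (W012.fn p x)]
      nlinarith [mul_nonneg s.2.1 (sq_nonneg |W012.fn w x|),
        mul_nonneg (sub_nonneg.2 s.2.2) (sq_nonneg |W012.fn p x|),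
        mul_nonneg (abs_nonneg (W012.fn w x)) (abs_nonneg (W012.fn p x))]
    · refine Continuous.tendsto (f := fun s : unitInterval =>
        √((1 - (s : ℝ)) * W012.fn w x ^ 2 + s * W012.fn p x ^ 2)) (by fun_prop) t
  have hgrad : Continuous fun t => W012.grad (z t) := continuous_iff_continuousAt.2 fun t => by
    refine Lp.tendsto_of_dominated hz' (hz' t)
      ((Lp.memLp (W012.grad w)).norm.add (Lp.memLp (W012.grad p)).norm)
      (fun s => .of_forall fun x => ?_) ?_
    · refine (norm_add_le _ _).trans (add_le_add ?_ ?_) <;> rw [norm_smul]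
      · exact mul_le_of_le_one_left (norm_nonneg _) (abs_div_le_one_of_abs_le (hb _ _ _).1)
      · exact mul_le_of_le_one_left (norm_nonneg _) (abs_div_le_one_of_abs_le (hb _ _ _).2)
    · filter_upwards [hw, hp] with x h1 h2
      have hc := continuous_mul_div_sqrt h1 h2
      exact ((hc.1.tendsto t).smul_const _).add ((hc.2.tendsto t).smul_const _)
  refine ⟨⟨⟨z, (hfn.prodMk hgrad).subtype_mk _⟩, ?_, ?_⟩, fun t =>
    energy_le_of_sqrt_convexCombination hΩb hq₁ hq₂ hα t.2.1 t.2.2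
      (hw.mono fun x h => h.le) hp (hz t) (hz' t)⟩
  · refine W012.ext_fn hΩ (Lp.ext ?_)
    filter_upwards [hz 0, hw] with x h1 h2
    rw [h1]
    simp [Real.sqrt_sq h2.le]
  · refine W012.ext_fn hΩ (Lp.ext ?_)
    filter_upwards [hz 1, hp] with x h1 h2
    rw [h1]
    simp [Real.sqrt_sq h2]

end

/-! ### Concatenation of the two legs. -/

theorem lemmaB1 {N : ℕ} {q α : ℝ} (hq₁ : 1 < q) (hq₂ : q < 2) (hα : 0 < α)
    {Ω : Set (EuclideanSpace ℝ (Fin N))} (hΩ_open : IsOpen Ω)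
    (hΩ_bdd : Bornology.IsBounded Ω) (hΩ_conn : IsConnected Ω)
    (w : W012 Ω) (hw : IsPositiveMinimizer q α w) (φ : W012 Ω) :
    ∃ φp : W012 Ω, W012.fn φp = Lp.posPart (W012.fn φ) ∧
      ∃ γ : unitInterval → W012 Ω, Continuous γ ∧ γ 0 = w ∧ γ 1 = φ ∧
        ∀ t, energy q α (γ t) ≤ max (energy q α φp) (energy q α φ) := by
  obtain ⟨φp, hφp⟩ := W012.exists_posPart φ
  refine ⟨φp, hφp, ?_⟩
  have hpos : ∀ᵐ x ∂(volume.restrict Ω), 0 ≤ W012.fn φp x := by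
    filter_upwards [Lp.coeFn_posPart (W012.fn φ)] with x hx
    rw [hφp, hx]
    exact le_max_right _ _
  obtain ⟨γ, hγ⟩ := W012.exists_path_energy_le hΩ_open hΩ_bdd hq₁ hq₂ hα hw.2 hpos
  -- Minimality, `F(w) ≤ F(φ⁺)`, turns the convex combination of energies into the bound `F(φ⁺)`.
  have hjoin : JoinedIn {v : W012 Ω | energy q α v ≤ max (energy q α φp) (energy q α φ)} w φp :=
    ⟨γ, fun t => le_max_of_le_left ((hγ t).trans (by
      nlinarith [mul_le_mul_of_nonneg_left (hw.1 φp) (sub_nonneg.2 t.2.2)]))⟩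
  obtain ⟨Γ, hΓ⟩ := hjoin.trans (W012.joinedIn_posPart hΩ_open hΩ_bdd hq₁ hq₂ hφp)
  exact ⟨Γ, Γ.continuous, Γ.source, Γ.target, hΓ⟩

end
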